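/- A continuum is a nonempty compact connected metric space, and a subcontinuum of a metric space $Y$ is a nonempty compact connected subset of $Y$. Let $Y$ be a continuum and let $A$ be a subcontinuum of $Y$. - $A$ is a nonblock subcontinuum of $Y$ if $A$ has empty interior in $Y$ and there is an increasing sequence $L_1\subseteq L_2\subseteq\cdots$ of subcontinua of $Y\setminus A$ such that $\bigcup_{n} L_n$ is dense in $Y\setminus A$. - $A$ is a shore subcontinuum of $Y$ if for every $\varepsilon>0$ there is a subcontinuum $W$ of $Y\setminus A$ that intersects every $\varepsilon$-ball of $Y$. - $A$ is not a strong centre in $Y$ if for every pair of nonempty open subsets $U,V$ of $Y$ there is a subcontinuum $W$ of $Y$ with $W\cap U\neq\emptyset$, $W\cap V\neq\emptyset$ and $W\cap A=\emptyset$. Let $X$ be a continuum, let $X^2=X\times X$ carry the metric $d((x,y),(x',y'))=\max\{d(x,x'),d(y,y')\}$, and let $\Delta_X=\{(x,x) : x\in X\}\subseteq X^2$ be the diagonal. Then the following are equivalent: 1. $\Delta_X$ is a nonblock subcontinuum of $X^2$; 2. $\Delta_X$ is a shore subcontinuum of $X^2$; 3. $\Delta_X$ is not a strong centre in $X^2$.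 -/

import Mathlib

/-- A subcontinuum of a metric space: a nonempty, compact, connected subset. -/
def IsSubcontinuum {Y : Type*} [MetricSpace Y] (W : Set Y) : Prop :=
  IsCompact W ∧ IsConnected W

/-- A nonblock subcontinuum `A` of `Y`: a subcontinuum with empty interior such that `Y \ A`
contains an increasing sequence of subcontinua whose union is dense in `Y \ A`. -/
def IsNonblockSubcontinuum {Y : Type*} [MetricSpace Y] (A : Set Y) : Prop :=
  IsSubcontinuum A ∧ interior A = ∅ ∧
    ∃ L : ℕ → Set Y, Monotone L ∧ (∀ n, IsSubcontinuum (L n) ∧ L n ⊆ Aᶜ) ∧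
      Aᶜ ⊆ closure (⋃ n, L n)

/-- A shore subcontinuum `A` of `Y`: for each `ε > 0` some subcontinuum of `Y \ A` meets every
`ε`-ball of `Y`. (This forces `A` to have empty interior.) -/
def IsShoreSubcontinuum {Y : Type*} [MetricSpace Y] (A : Set Y) : Prop :=
  IsSubcontinuum A ∧
    ∀ ε : ℝ, 0 < ε → ∃ W : Set Y, IsSubcontinuum W ∧ W ⊆ Aᶜ ∧
      ∀ y : Y, (Metric.ball y ε ∩ W).Nonempty

/-- `A` is a strong centre in `Y`: there are nonempty open sets `U`, `V` such that every
subcontinuum of `Y` that meets both `U` and `V` also meets `A`.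
(Taking `U = V = interior A`, a set with nonempty interior is always a strong centre.) -/
def IsStrongCentre {Y : Type*} [MetricSpace Y] (A : Set Y) : Prop :=
  ∃ U V : Set Y, IsOpen U ∧ IsOpen V ∧ U.Nonempty ∧ V.Nonempty ∧
    ∀ W : Set Y, IsSubcontinuum W → (W ∩ U).Nonempty → (W ∩ V).Nonempty → (W ∩ A).Nonempty

open Set TopologicalSpace

section General

variable {Y : Type*} [MetricSpace Y]

/-! The substance is that a diagonal that is not a strong centre is nonblock. It suffices to find a
point `(x, y)` joined, off the diagonal, to every nonempty open set. If `X` is indecomposable, its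
composants are meagre and dense. Take `x`, `y` in different composants: products of proper
subcontinua `K ∋ x`, `L ∋ y` miss the diagonal and reach every open set. If `X = K ∪ L` properly,
with `x, a ∉ L` and `y ∉ K`, the cross `K × {y} ∪ {a} × L` misses the diagonal. It links `(x, y)` to
a continuum, supplied by the hypothesis, from `Lᶜ × Kᶜ` to the target. -/

theorem IsSubcontinuum.union {K L : Set Y} (hK : IsSubcontinuum K) (hL : IsSubcontinuum L)
    (h : (K ∩ L).Nonempty) : IsSubcontinuum (K ∪ L) :=
  ⟨hK.1.union hL.1, hK.2.union h hL.2⟩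

theorem IsSubcontinuum.prod {Z : Type*} [MetricSpace Z] {K : Set Y} {L : Set Z}
    (hK : IsSubcontinuum K) (hL : IsSubcontinuum L) : IsSubcontinuum (K ×ˢ L) :=
  ⟨hK.1.prod hL.1, hK.2.prod hL.2⟩

theorem isSubcontinuum_singleton (x : Y) : IsSubcontinuum ({x} : Set Y) :=
  ⟨isCompact_singleton, isConnected_singleton⟩

theorem isSubcontinuum_diagonal [CompactSpace Y] [ConnectedSpace Y] :
    IsSubcontinuum (diagonal Y) := by
  rw [← range_diag]
  exact ⟨isCompact_range (by fun_prop), isConnected_range (by fun_prop)⟩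

theorem IsNonblockSubcontinuum.isShoreSubcontinuum [CompactSpace Y] {A : Set Y}
    (h : IsNonblockSubcontinuum A) : IsShoreSubcontinuum A := by
  obtain ⟨hA, hint, L, hmono, hL, hdense⟩ := h
  refine ⟨hA, fun ε hε => ?_⟩
  have hd : Dense (⋃ n, L n) := by
    have h1 : Dense Aᶜ := interior_eq_empty_iff_dense_compl.1 hint
    exact dense_closure.1 (h1.mono hdense)
  have hcover : (univ : Set Y) ⊆ ⋃ n, Metric.thickening ε (L n) := by
    intro y _
    obtain ⟨z, hz, hyz⟩ := hd.exists_dist_lt y hε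
    obtain ⟨n, hn⟩ := mem_iUnion.1 hz
    exact mem_iUnion.2 ⟨n, Metric.mem_thickening_iff.2 ⟨z, hn, hyz⟩⟩
  -- The thickenings increase with `n`, so by compactness a single one is everything.
  obtain ⟨n, hn⟩ := isCompact_univ.elim_directed_cover _
    (fun n => Metric.isOpen_thickening) hcover
    (Monotone.directed_le fun i j hij => Metric.thickening_subset_of_subset ε (hmono hij))
  refine ⟨L n, (hL n).1, (hL n).2, fun y => ?_⟩
  obtain ⟨z, hz, hyz⟩ := Metric.mem_thickening_iff.1 (hn (mem_univ y))
  exact ⟨z, by rwa [Metric.mem_ball'], hz⟩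

theorem IsShoreSubcontinuum.not_isStrongCentre {A : Set Y} (h : IsShoreSubcontinuum A) :
    ¬ IsStrongCentre A := by
  rintro ⟨U, V, hU, hV, ⟨u, hu⟩, ⟨v, hv⟩, hW⟩
  obtain ⟨ε, hε, hεU⟩ := Metric.isOpen_iff.1 hU u hu
  obtain ⟨δ, hδ, hδV⟩ := Metric.isOpen_iff.1 hV v hv
  obtain ⟨W, hWc, hWA, hWb⟩ := h.2 (min ε δ) (lt_min hε hδ)
  obtain ⟨a, ha, haW⟩ := hWb u
  obtain ⟨b, hb, hbW⟩ := hWb v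
  obtain ⟨c, hcW, hcA⟩ := hW W hWc
    ⟨a, haW, hεU (Metric.ball_subset_ball (min_le_left _ _) ha)⟩
    ⟨b, hbW, hδV (Metric.ball_subset_ball (min_le_right _ _) hb)⟩
  exact hWA hcW hcA

theorem interior_eq_empty_of_not_isStrongCentre {A : Set Y} (h : ¬ IsStrongCentre A) :
    interior A = ∅ := by
  by_contra hne
  have hne := nonempty_iff_ne_empty.2 hne
  exact h ⟨interior A, interior A, isOpen_interior, isOpen_interior, hne, hne,
    fun W _ hW _ => hW.mono (inter_subset_inter_right _ interior_subset)⟩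

/-- A subcontinuum with empty interior is nonblock as soon as some continuum component of its
complement is dense. -/
theorem isNonblockSubcontinuum_of_dense [CompactSpace Y] {A : Set Y} (hA : IsSubcontinuum A)
    (hint : interior A = ∅) (p : Y)
    (hp : ∀ V : Set Y, IsOpen V → V.Nonempty →
      ∃ W, IsSubcontinuum W ∧ W ⊆ Aᶜ ∧ p ∈ W ∧ (W ∩ V).Nonempty) :
    IsNonblockSubcontinuum A := by
  have hne : (countableBasis Y).Nonempty := by
    obtain ⟨b, hb, -⟩ := (isBasis_countableBasis Y).exists_subset_of_mem_open
      (mem_univ p) isOpen_univ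
    exact ⟨b, hb⟩
  obtain ⟨B, hB⟩ := (countable_countableBasis Y).exists_eq_range hne
  have hBmem : ∀ n, B n ∈ countableBasis Y := fun n => hB ▸ mem_range_self n
  choose W hWc hWA hpW hWB using fun n =>
    hp (B n) (isOpen_of_mem_countableBasis (hBmem n)) (nonempty_of_mem_countableBasis (hBmem n))
  refine ⟨hA, hint, accumulate W, monotone_accumulate, fun n => ⟨⟨?_, ?_⟩, ?_⟩, ?_⟩
  · exact (finite_Iic n).isCompact_biUnion fun i _ => (hWc i).1
  · refine ⟨⟨p, mem_accumulate.2 ⟨n, le_rfl, hpW n⟩⟩, ?_⟩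
    have himage : accumulate W n = ⋃₀ (W '' Iic n) := by rw [sUnion_image]; rfl
    rw [himage]
    refine isPreconnected_sUnion p _ ?_ ?_
    · rintro _ ⟨i, -, rfl⟩
      exact hpW i
    · rintro _ ⟨i, -, rfl⟩
      exact (hWc i).2.isPreconnected
  · exact iUnion₂_subset fun i _ => hWA i
  · rw [iUnion_accumulate]
    intro y _
    rw [(isBasis_countableBasis Y).mem_closure_iff]
    intro b hb _
    obtain ⟨n, rfl⟩ := hB ▸ hb
    obtain ⟨z, hzW, hzB⟩ := hWB n
    exact ⟨z, hzB, mem_iUnion.2 ⟨n, hzW⟩⟩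

end General

/-! ### Indecomposability, boundary bumping and composants -/

section Composants

variable {X : Type*} [MetricSpace X] [CompactSpace X] [ConnectedSpace X]

/-- The union of a connected set with one side of a separation of its complement is connected. -/
theorem IsPreconnected.union_of_separation {α : Type*} [TopologicalSpace α]
    [PreconnectedSpace α] {K P Q : Set α} (hK : IsPreconnected K) (hne : K.Nonempty)
    (hP : IsClosed (K ∪ P)) (hQ : IsClosed (K ∪ Q)) (hPQ : Disjoint P Q)
    (hcover : K ∪ P ∪ Q = univ) : IsPreconnected (K ∪ P) := by
  have key : ∀ u v : Set α, IsClosed u → IsClosed v → K ∪ P ⊆ u ∪ v →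
      (K ∪ P) ∩ (u ∩ v) = ∅ → K ⊆ u → (K ∪ P) ∩ v = ∅ := by
    intro u v hu hv huv hdis hKu
    have hdis' : ∀ x ∈ K ∪ P, x ∈ u → x ∉ v := fun x hx hxu hxv =>
      (hdis ▸ (⟨hx, hxu, hxv⟩ : x ∈ (K ∪ P) ∩ (u ∩ v)) : x ∈ (∅ : Set α))
    by_contra hne'
    -- These two closed sets would separate the whole space: `K ⊆ u`, and `Q` is disjoint from `P`.
    have hpre := isPreconnected_closed_iff.1 (isPreconnected_univ (α := α))
      (((K ∪ P) ∩ u) ∪ (K ∪ Q)) ((K ∪ P) ∩ v) ((hP.inter hu).union hQ) (hP.inter hv) ?_ ?_ ?_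
    · obtain ⟨x, -, hx1, hx2, hxv⟩ := hpre
      have hxu : x ∉ u := fun h => hdis' x hx2 h hxv
      have hxK : x ∉ K := fun h => hxu (hKu h)
      have hxP : x ∈ P := hx2.resolve_left hxK
      rcases hx1 with h | h | h
      · exact hxu h.2
      · exact hxK h
      · exact disjoint_left.1 hPQ hxP h
    · intro x hx
      rw [← hcover] at hx
      rcases hx with hx | hx
      · rcases huv hx with h | h
        · exact Or.inl (Or.inl ⟨hx, h⟩)
        · exact Or.inr ⟨hx, h⟩
      · exact Or.inl (Or.inr (Or.inr hx))
    · obtain ⟨k, hk⟩ := hne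
      exact ⟨k, mem_univ k, Or.inr (Or.inl hk)⟩
    · obtain ⟨x, hx⟩ := nonempty_iff_ne_empty.2 hne'
      exact ⟨x, mem_univ x, hx⟩
  rw [isPreconnected_closed_iff]
  intro u v hu hv huv hnu hnv
  by_contra hdis
  rw [not_nonempty_iff_eq_empty] at hdis
  have hKuv : K ∩ (u ∩ v) = ∅ :=
    subset_empty_iff.1 (hdis ▸ inter_subset_inter_left _ subset_union_left)
  rcases isPreconnected_iff_subset_of_disjoint_closed.1 hK u v hu hv
    (subset_union_left.trans huv) hKuv with h | h
  · exact hnv.ne_empty (key u v hu hv huv hdis h)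
  · exact hnu.ne_empty (key v u hv hu (by rwa [union_comm v u]) (by rwa [inter_comm v u]) h)

/-- In a continuum which is not the union of two proper subcontinua, proper subcontinua have
empty interior. -/
theorem interior_eq_empty_of_indecomposable
    (hX : ∀ K L : Set X, IsSubcontinuum K → IsSubcontinuum L → K ∪ L = univ →
      K = univ ∨ L = univ)
    {K : Set X} (hK : IsSubcontinuum K) (hne : K ≠ univ) : interior K = ∅ := by
  have hKcl : IsClosed K := hK.1.isClosed
  -- Either `K` and `closure Kᶜ` cover `X`, or `K` joined to each side of a separation of `Kᶜ` gives
  -- a forbidden decomposition.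
  by_cases hconn : IsPreconnected Kᶜ
  · have hcl : IsSubcontinuum (closure Kᶜ) :=
      ⟨isClosed_closure.isCompact, (nonempty_compl.2 hne).closure, hconn.closure⟩
    have hun : K ∪ closure Kᶜ = univ :=
      univ_subset_iff.1 ((union_compl_self K).symm.subset.trans
        (union_subset_union_right K subset_closure))
    have h := (hX _ _ hK hcl hun).resolve_left hne
    rwa [closure_compl, compl_univ_iff] at h
  · exfalso
    rw [isPreconnected_iff_subset_of_disjoint] at hconn
    push Not at hconn
    obtain ⟨u, v, hu, hv, huv, hdis, hnu, hnv⟩ := hconn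
    have hside : ∀ u v : Set X, IsOpen u → IsOpen v → Kᶜ ⊆ u ∪ v → Kᶜ ∩ (u ∩ v) = ∅ →
        IsSubcontinuum (K ∪ Kᶜ ∩ u) := by
      intro u v hu hv huv hdis
      have hcl : ∀ u v : Set X, IsOpen v → Kᶜ ⊆ u ∪ v → Kᶜ ∩ (u ∩ v) = ∅ →
          IsClosed (K ∪ Kᶜ ∩ u) := by
        intro u v hv huv hdis
        have : K ∪ Kᶜ ∩ u = (Kᶜ ∩ v)ᶜ := by
          ext x
          have h1 := @huv x
          have h2 : x ∉ Kᶜ ∩ (u ∩ v) := by simp [hdis]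
          simp only [mem_union, mem_inter_iff, mem_compl_iff] at *
          tauto
        rw [this]
        exact (hKcl.isOpen_compl.inter hv).isClosed_compl
      have h1 := hcl u v hv huv hdis
      have h2 := hcl v u hu (by rwa [union_comm]) (by rwa [inter_comm v u])
      refine ⟨h1.isCompact, hK.2.nonempty.mono subset_union_left,
        hK.2.isPreconnected.union_of_separation hK.2.nonempty h1 h2 ?_ ?_⟩
      · rw [disjoint_iff_inter_eq_empty, ← inter_inter_distrib_left, hdis]
      · rw [union_assoc, ← inter_union_distrib_left, inter_eq_left.2 huv, union_compl_self]
    have hdis' : Kᶜ ∩ (v ∩ u) = ∅ := by rwa [inter_comm v u]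
    have huv' : Kᶜ ⊆ v ∪ u := by rwa [union_comm]
    have hproper : ∀ u : Set X, K ∪ Kᶜ ∩ u = univ → Kᶜ ⊆ u := fun u h x hx =>
      ((h.symm.subset (mem_univ x)).resolve_left hx).2
    rcases hX _ _ (hside u v hu hv huv hdis) (hside v u hv hu huv' hdis') (by
      rw [← union_union_distrib_left, ← inter_union_distrib_left, inter_eq_left.2 huv,
        union_compl_self]) with h | h
    · exact hnu (hproper u h)
    · exact hnv (hproper v h)

/-- Boundary bumping: the component of a closed set `F ≠ univ` containing a given point reaches
the closure of the complement of `F`. -/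
theorem exists_isSubcontinuum_subset_inter_closure_compl {F : Set X} (hF : IsClosed F)
    (hne : F ≠ univ) {x : X} (hx : x ∈ F) :
    ∃ K, IsSubcontinuum K ∧ x ∈ K ∧ K ⊆ F ∧ (K ∩ closure Fᶜ).Nonempty := by
  have hFc : CompactSpace F := isCompact_iff_compactSpace.1 hF.isCompact
  set C : Set F := connectedComponent ⟨x, hx⟩ with hC
  refine ⟨Subtype.val '' C, ⟨isClosed_connectedComponent.isCompact.image continuous_subtype_val,
    isConnected_connectedComponent.image _ continuous_subtype_val.continuousOn⟩,
    ⟨⟨x, hx⟩, mem_connectedComponent, rfl⟩, by simp, ?_⟩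
  -- Otherwise compactness puts a clopen subset of `F` containing `x` inside the interior of `F`; it
  -- is then clopen in `X`, contradicting connectedness.
  by_contra hempty
  rw [not_nonempty_iff_eq_empty] at hempty
  set O : Set F := Subtype.val ⁻¹' (closure Fᶜ)ᶜ with hO
  have hOopen : IsOpen O := isClosed_closure.isOpen_compl.preimage continuous_subtype_val
  have hCO : C ⊆ O := fun z hz hz' =>
    (hempty ▸ (⟨⟨z, hz, rfl⟩, hz'⟩ : (z : X) ∈ Subtype.val '' C ∩ closure Fᶜ) :
      (z : X) ∈ (∅ : Set X))
  rw [hC, connectedComponent_eq_iInter_isClopen] at hCO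
  have : Nonempty { s : Set F // IsClopen s ∧ (⟨x, hx⟩ : F) ∈ s } :=
    ⟨⟨univ, isClopen_univ, mem_univ _⟩⟩
  obtain ⟨⟨E, hE, hxE⟩, hEO⟩ := exists_subset_nhds_of_isCompact'
    (V := fun s : { s : Set F // IsClopen s ∧ (⟨x, hx⟩ : F) ∈ s } => (s : Set F))
    (fun s t => ⟨⟨s.1 ∩ t.1, s.2.1.inter t.2.1, s.2.2, t.2.2⟩,
      inter_subset_left, inter_subset_right⟩)
    (fun s => s.2.1.isClosed.isCompact) (fun s => s.2.1.isClosed)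
    (fun z hz => hOopen.mem_nhds (hCO hz))
  have hclosed : IsClosed (Subtype.val '' E) := hF.isClosedEmbedding_subtypeVal.isClosedMap _ hE.1
  obtain ⟨G, hG, hGE⟩ := isOpen_induced_iff.1 hE.2
  have hopen : IsOpen (Subtype.val '' E) := by
    have : Subtype.val '' E = G ∩ (closure Fᶜ)ᶜ := by
      ext z
      constructor
      · rintro ⟨w, hw, rfl⟩
        exact ⟨(hGE ▸ hw : w ∈ Subtype.val ⁻¹' G), hEO hw⟩
      · rintro ⟨hzG, hz⟩
        have hzF : z ∈ F := notMem_compl_iff.1 fun h => hz (subset_closure h)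
        exact ⟨⟨z, hzF⟩, hGE ▸ hzG, rfl⟩
    rw [this]
    exact hG.inter isClosed_closure.isOpen_compl
  have huniv := IsClopen.eq_univ ⟨hclosed, hopen⟩ ⟨x, ⟨x, hx⟩, hxE, rfl⟩
  exact hne (univ_subset_iff.1 (huniv ▸ by simp))

/-- Composants are dense. -/
theorem exists_proper_isSubcontinuum_inter_nonempty [Nontrivial X] (x : X) {V : Set X}
    (hV : IsOpen V) (hne : V.Nonempty) :
    ∃ K, IsSubcontinuum K ∧ K ≠ univ ∧ x ∈ K ∧ (K ∩ V).Nonempty := by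
  by_cases hx : x ∈ V
  · refine ⟨{x}, isSubcontinuum_singleton x, ?_, rfl, ⟨x, rfl, hx⟩⟩
    obtain ⟨y, hy⟩ := exists_ne x
    exact fun h => hy (h.symm.subset (mem_univ y))
  · obtain ⟨v, hv⟩ := hne
    obtain ⟨r, hr, hrV⟩ := Metric.nhds_basis_closedBall.mem_iff.1 (hV.mem_nhds hv)
    have hvF : v ∉ (Metric.ball v r)ᶜ := fun h => h (Metric.mem_ball_self hr)
    obtain ⟨K, hK, hxK, hKF, z, hzK, hz⟩ := exists_isSubcontinuum_subset_inter_closure_compl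
      (F := (Metric.ball v r)ᶜ) Metric.isOpen_ball.isClosed_compl
      (fun h => hvF (h ▸ mem_univ v))
      (fun h => hx (hrV (Metric.ball_subset_closedBall h)))
    rw [compl_compl] at hz
    exact ⟨K, hK, fun h => hvF (hKF (h ▸ mem_univ v)), hxK, z, hzK,
      hrV (Metric.closure_ball_subset_closedBall hz)⟩

/-- In a continuum whose proper subcontinua have empty interior, no composant is everything. -/
theorem exists_forall_proper_isSubcontinuum_notMem
    (hX : ∀ K : Set X, IsSubcontinuum K → K ≠ univ → interior K = ∅) (x : X) :
    ∃ y, ∀ K, IsSubcontinuum K → K ≠ univ → x ∈ K → y ∉ K := by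
  -- Each proper subcontinuum through `x` misses some basic open `b`, so lies in `S b`; Baire then
  -- applies to countably many nowhere dense sets.
  let S : Set X → Set X := fun b => connectedComponentIn bᶜ x
  have hS : ∀ b ∈ countableBasis X, IsOpen (S b)ᶜ ∧ Dense (S b)ᶜ := by
    intro b hb
    by_cases hx : x ∈ bᶜ
    · have hcl : IsClosed (S b) := isClosed_of_closure_subset
        (isPreconnected_connectedComponentIn.closure.subset_connectedComponentIn
          (subset_closure (mem_connectedComponentIn hx))
          (closure_minimal (connectedComponentIn_subset _ _)
            (isOpen_of_mem_countableBasis hb).isClosed_compl))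
      have hsub : IsSubcontinuum (S b) :=
        ⟨hcl.isCompact, isConnected_connectedComponentIn_iff.2 hx⟩
      refine ⟨hcl.isOpen_compl, interior_eq_empty_iff_dense_compl.1 (hX _ hsub fun h => ?_)⟩
      obtain ⟨z, hz⟩ := nonempty_of_mem_countableBasis hb
      exact connectedComponentIn_subset bᶜ x (h ▸ mem_univ z : z ∈ S b) hz
    · have : S b = ∅ := connectedComponentIn_eq_empty hx
      simp [this]
  obtain ⟨y, hy⟩ := (dense_biInter_of_isOpen (fun b hb => (hS b hb).1)
    (countable_countableBasis X) (fun b hb => (hS b hb).2)).nonempty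
  refine ⟨y, fun K hK hne hxK hyK => ?_⟩
  obtain ⟨z, hz⟩ := nonempty_compl.2 hne
  obtain ⟨b, hb, -, hbK⟩ := (isBasis_countableBasis X).exists_subset_of_mem_open hz
    hK.1.isClosed.isOpen_compl
  exact mem_iInter₂.1 hy b hb
    (hK.2.isPreconnected.subset_connectedComponentIn hxK (subset_compl_comm.1 hbK) hyK)

end Composants

/-! ### The diagonal: indecomposable and decomposable cases -/

section Diagonal

variable {X : Type*} [MetricSpace X] [CompactSpace X] [ConnectedSpace X]

theorem isNonblockSubcontinuum_diagonal_of_indecomposable [Nontrivial X]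
    (hint : interior (diagonal X) = ∅)
    (hX : ∀ K L : Set X, IsSubcontinuum K → IsSubcontinuum L → K ∪ L = univ →
      K = univ ∨ L = univ) :
    IsNonblockSubcontinuum (diagonal X) := by
  obtain ⟨x⟩ : Nonempty X := inferInstance
  obtain ⟨y, hy⟩ := exists_forall_proper_isSubcontinuum_notMem
    (fun K hK hne => interior_eq_empty_of_indecomposable hX hK hne) x
  refine isNonblockSubcontinuum_of_dense isSubcontinuum_diagonal hint (x, y) ?_
  rintro V hV ⟨⟨a, b⟩, hab⟩
  obtain ⟨U₁, U₂, hU₁, hU₂, ha, hb, hU⟩ := isOpen_prod_iff.1 hV a b hab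
  obtain ⟨K, hK, hKne, hxK, a', haK, haU⟩ :=
    exists_proper_isSubcontinuum_inter_nonempty x hU₁ ⟨a, ha⟩
  obtain ⟨L, hL, hLne, hyL, b', hbL, hbU⟩ :=
    exists_proper_isSubcontinuum_inter_nonempty y hU₂ ⟨b, hb⟩
  refine ⟨K ×ˢ L, hK.prod hL, ?_, ⟨hxK, hyL⟩, (a', b'), ⟨haK, hbL⟩, hU ⟨haU, hbU⟩⟩
  rintro ⟨c, d⟩ ⟨hcK, hdL⟩ (rfl : c = d)
  -- A common point would make `K ∪ L` a proper subcontinuum containing `x` and `y`.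
  refine hy (K ∪ L) (hK.union hL ⟨c, hcK, hdL⟩) (fun h => ?_) (Or.inl hxK) (Or.inr hyL)
  exact (hX K L hK hL h).elim hKne hLne

theorem isNonblockSubcontinuum_diagonal_of_decomposable
    (h : ¬ IsStrongCentre (diagonal X)) {K L : Set X} (hK : IsSubcontinuum K)
    (hL : IsSubcontinuum L) (hKL : K ∪ L = univ) (hKne : K ≠ univ) (hLne : L ≠ univ) :
    IsNonblockSubcontinuum (diagonal X) := by
  obtain ⟨y, hy⟩ := nonempty_compl.2 hKne
  obtain ⟨x, hx⟩ := nonempty_compl.2 hLne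
  have hmemL : ∀ z ∉ K, z ∈ L := fun z hz => (hKL.symm.subset (mem_univ z)).resolve_left hz
  have hmemK : ∀ z ∉ L, z ∈ K := fun z hz => (hKL.symm.subset (mem_univ z)).resolve_right hz
  refine isNonblockSubcontinuum_of_dense isSubcontinuum_diagonal
    (interior_eq_empty_of_not_isStrongCentre h) (x, y) fun V hV hVne => ?_
  obtain ⟨W, hW, ⟨⟨a, b⟩, habW, ha, hb⟩, hWV, hWd⟩ :
      ∃ W, IsSubcontinuum W ∧ (W ∩ Lᶜ ×ˢ Kᶜ).Nonempty ∧ (W ∩ V).Nonempty ∧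
        ¬ (W ∩ diagonal X).Nonempty := by
    by_contra hcon
    push Not at hcon
    refine h ⟨Lᶜ ×ˢ Kᶜ, V, hL.1.isClosed.isOpen_compl.prod hK.1.isClosed.isOpen_compl, hV,
      ⟨(x, y), hx, hy⟩, hVne, fun W hW h1 h2 => ?_⟩
    exact hcon W hW h1 h2
  -- The vertical bar stands over `a`, the first coordinate of a point of `W`, so that the cross
  -- meets `W`.
  have hcross : IsSubcontinuum (K ×ˢ {y} ∪ {a} ×ˢ L) :=
    (hK.prod (isSubcontinuum_singleton y)).union ((isSubcontinuum_singleton a).prod hL)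
      ⟨(a, y), ⟨hmemK a ha, rfl⟩, rfl, hmemL y hy⟩
  refine ⟨(K ×ˢ {y} ∪ {a} ×ˢ L) ∪ W,
    hcross.union hW ⟨(a, b), Or.inr ⟨rfl, hmemL b hb⟩, habW⟩, ?_,
    Or.inl (Or.inl ⟨hmemK x hx, rfl⟩),
    hWV.mono (inter_subset_inter_left _ subset_union_right)⟩
  rintro ⟨c, d⟩ hcd (rfl : c = d)
  rcases hcd with (⟨hc, rfl⟩ | ⟨rfl, hc⟩) | hc
  · exact hy hc
  · exact ha hc
  · exact hWd ⟨(c, c), hc, rfl⟩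

theorem isNonblockSubcontinuum_diagonal_of_not_isStrongCentre
    (h : ¬ IsStrongCentre (diagonal X)) : IsNonblockSubcontinuum (diagonal X) := by
  have hint := interior_eq_empty_of_not_isStrongCentre h
  by_cases hX : ∀ K L : Set X, IsSubcontinuum K → IsSubcontinuum L → K ∪ L = univ →
      K = univ ∨ L = univ
  · have : Nontrivial X := by
      by_contra hn
      rw [not_nontrivial_iff_subsingleton] at hn
      obtain ⟨x⟩ : Nonempty X := inferInstance
      have huniv : diagonal X = univ := eq_univ_of_forall fun p => Subsingleton.elim _ _
      rw [huniv, interior_univ] at hint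
      exact (hint.subset (mem_univ (x, x)) : (x, x) ∈ (∅ : Set (X × X)))
    exact isNonblockSubcontinuum_diagonal_of_indecomposable hint hX
  · push Not at hX
    obtain ⟨K, L, hK, hL, hKL, hKne, hLne⟩ := hX
    exact isNonblockSubcontinuum_diagonal_of_decomposable h hK hL hKL hKne hLne

end Diagonal

theorem corollary3p10 {X : Type*} [MetricSpace X] [CompactSpace X] [ConnectedSpace X] :
    List.TFAE
      [IsNonblockSubcontinuum (Set.diagonal X),
       IsShoreSubcontinuum (Set.diagonal X),
       ¬ IsStrongCentre (Set.diagonal X)] := by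
  tfae_have 1 → 2 := fun h => h.isShoreSubcontinuum
  tfae_have 2 → 3 := fun h => h.not_isStrongCentre
  tfae_have 3 → 1 := isNonblockSubcontinuum_diagonal_of_not_isStrongCentre
  tfae_finish
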